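/- Let $(\Omega,\mathcal F,P)$ be a probability space, let $L^0$ be the space of (a.s. equivalence classes of) real random variables with the a.s. order and the topology of convergence in probability. Let $\mathcal X$ be either $L^\infty$ with the weak-star topology $\sigma(L^\infty,L^1)$, or a linear subspace of $L^0$ that is a Fréchet lattice for the a.s. order (a completely metrizable, locally solid Riesz space, not necessarily locally convex) such that: $X_n\downarrow 0$ a.s. implies $X_n\to0$ in $\mathcal X$; $L^\infty$ (with the essential supremum norm) is densely and continuously embedded in $\mathcal X$, and $\mathcal X$ is densely and continuously embedded in $L^0$; and $1_A\mathcal X\subset\mathcal X$ for every $A\in\mathcal F$. Write $X^-=\max\{-X,0\}$, $\mathcal X(A)=1_A\mathcal X=\{1_AX: X\in\mathcal X\}$, $\mathcal X_+(A)=\{X\in\mathcal X(A): X\ge0\}$, $\mathcal X_-(A)=\{X\in\mathcal X(A): X\le 0\}$. An acceptance set is a non-empty, strict subset $\mathcal A\subset\mathcal X$ such that $X\in\mathcal A$, $Y\in\mathcal X$, $Y\ge X$ imply $Y\in\mathcal A$. It is surplus invariant if $X\in\mathcal A$, $Y\in\mathcal X$, $Y^-\le X^-$ imply $Y\in\mathcal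 A$. Theorem. Let $\mathcal A\subset\mathcal X$ be a closed, convex acceptance set. Then $\mathcal A$ is surplus invariant if and only if there exists a measurable partition $\{A,B,C\}$ of $\Omega$ (members may be empty) with $P(C)<1$, unique up to modifications on sets of probability zero, such that $$\mathcal A=\mathcal X_+(A)\oplus(\mathcal X_+(B)+\mathcal D_B)\oplus\mathcal X(C)$$ for some set $\mathcal D_B\subset\mathcal X_-(B)$ with the following properties: $\mathcal D_B$ is closed in $\mathcal X$ and convex; solid, i.e. $X\in\mathcal D_B$, $Y\in\mathcal X$, $X\le Y\le0$ imply $Y\in\mathcal D_B$; tight, i.e. for every $\varepsilon\in(0,1)$ there is $M>0$ with $P(-M<X<M)>\varepsilon$ for all $X\in\mathcal D_B$; and for every measurable $E\subset B$ with $P(E)>0$ there is $X\in\mathcal D_B$ with $P(1_EX<0)>0$. Here $\oplus$ means that every element of $\mathcal A$ is in exactly one way a sum of elements of the three sets, and that all such sums lie in $\mathcal A$. -/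

import Mathlib

open MeasureTheory Filter Topology
open scoped ENNReal Pointwise

/-- The metric `d(X, Y) = E[min (|X - Y|, 1)]` on `L⁰`, which metrizes convergence in
probability. -/
@[reducible]
noncomputable def convInProbPseudoEMetric {Ω : Type*} [MeasurableSpace Ω] (P : Measure Ω) :
    PseudoEMetricSpace (Ω →ₘ[P] ℝ) where
  edist X Y := ∫⁻ ω, min (edist (X ω) (Y ω)) 1 ∂P
  edist_self X := by simp
  edist_comm X Y := by simp only [edist_comm]
  edist_triangle X Y Z := by
    have hm : AEMeasurable (fun ω => min (edist (X ω) (Y ω)) 1) P :=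
      (X.aestronglyMeasurable.edist Y.aestronglyMeasurable).min aemeasurable_const
    rw [← lintegral_add_left' hm]
    refine lintegral_mono fun ω => ?_
    calc min (edist (X ω) (Z ω)) 1
        ≤ min (edist (X ω) (Y ω) + edist (Y ω) (Z ω)) 1 :=
          min_le_min_right _ (edist_triangle _ _ _)
      _ ≤ min (edist (X ω) (Y ω)) 1 + min (edist (Y ω) (Z ω)) 1 := by
          rcases le_total (edist (X ω) (Y ω)) 1 with h | h
          · rcases le_total (edist (Y ω) (Z ω)) 1 with h' | h'
            · rw [min_eq_left h, min_eq_left h']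
              exact min_le_left _ _
            · rw [min_eq_right h']
              exact (min_le_right _ _).trans le_add_self
          · rw [min_eq_right h]
            exact (min_le_right _ _).trans le_self_add

/-- The topology of convergence in probability on `L⁰`. -/
@[reducible]
noncomputable def convInProbTopology {Ω : Type*} [MeasurableSpace Ω] (P : Measure Ω) :
    TopologicalSpace (Ω →ₘ[P] ℝ) :=
  (convInProbPseudoEMetric P).toUniformSpace.toTopologicalSpace

/-- The weak-star topology `σ(L^∞, L¹)`: the coarsest topology that makes `X ↦ E[X Z]` continuous
for every `Z ∈ L¹`. It is used below only for `𝒳 = L^∞`, where all these expectations exist. -/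
@[reducible]
noncomputable def weakStarTopology {Ω : Type*} [MeasurableSpace Ω] (P : Measure Ω)
    (𝒳 : Submodule ℝ (Ω →ₘ[P] ℝ)) : TopologicalSpace 𝒳 :=
  TopologicalSpace.induced
    (fun (X : 𝒳) (Z : Lp ℝ 1 P) => ∫ ω, (X : Ω →ₘ[P] ℝ) ω * (Z : Ω →ₘ[P] ℝ) ω ∂P)
    inferInstance

/-- `𝒳`, with the given topology, is a linear subspace of `L⁰` that is a Fréchet lattice for the
almost sure order (a completely metrizable, locally solid Riesz space; local convexity is not
required), has the `σ`-Lebesgue property and the localization property, and satisfies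
`L^∞ ↪ 𝒳 ↪ L⁰` with dense, continuous embeddings. -/
structure IsFrechetAmbientSpace {Ω : Type*} [MeasurableSpace Ω] (P : Measure Ω)
    (𝒳 : Submodule ℝ (Ω →ₘ[P] ℝ)) [TopologicalSpace 𝒳] : Prop where
  /-- Riesz space. -/
  sup_mem : ∀ X ∈ 𝒳, ∀ Y ∈ 𝒳, X ⊔ Y ∈ 𝒳
  /-- Linear topology. -/
  isTopologicalAddGroup : IsTopologicalAddGroup 𝒳
  continuousSMul : ContinuousSMul ℝ 𝒳
  /-- Complete metrizability. -/
  isCompletelyMetrizable : TopologicalSpace.IsCompletelyMetrizableSpace 𝒳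
  /-- Zero has a neighbourhood base of solid sets. -/
  locallySolid : ∀ U ∈ 𝓝 (0 : 𝒳), ∃ V ∈ 𝓝 (0 : 𝒳), V ⊆ U ∧
    ∀ X ∈ V, ∀ Y : 𝒳, |(Y : Ω →ₘ[P] ℝ)| ≤ |(X : Ω →ₘ[P] ℝ)| → Y ∈ V
  /-- The `σ`-Lebesgue property: `Xₙ ↓ 0` almost surely implies `Xₙ → 0` in `𝒳`. -/
  sigmaLebesgue : ∀ X : ℕ → 𝒳, Antitone (fun n => (X n : Ω →ₘ[P] ℝ)) →
    (∀ᵐ ω ∂P, Tendsto (fun n => (X n : Ω →ₘ[P] ℝ) ω) atTop (𝓝 0)) →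
    Tendsto X atTop (𝓝 0)
  /-- `L^∞`, with the essential supremum norm, embeds densely and continuously into `𝒳`. -/
  embedding_Linfty : ∃ h : ∀ f ∈ Lp ℝ ∞ P, f ∈ 𝒳,
    Continuous (fun f : Lp ℝ ∞ P => (⟨f.1, h f.1 f.2⟩ : 𝒳)) ∧
    DenseRange (fun f : Lp ℝ ∞ P => (⟨f.1, h f.1 f.2⟩ : 𝒳))
  /-- `𝒳` embeds densely and continuously into `L⁰` with convergence in probability. -/
  continuous_toL0 : @Continuous 𝒳 (Ω →ₘ[P] ℝ) _ (convInProbTopology P) Subtype.val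
  dense_toL0 : @Dense (Ω →ₘ[P] ℝ) (convInProbTopology P) 𝒳
  /-- The localization property `1_A 𝒳 ⊆ 𝒳`. -/
  localization : ∀ A : Set Ω, MeasurableSet A → ∀ X ∈ 𝒳, ∃ Y ∈ 𝒳, Y =ᵐ[P] A.indicator X

/-- The admissible ambient spaces: `L^∞` with the weak-star topology `σ(L^∞, L¹)`, or a Fréchet
lattice as in `IsFrechetAmbientSpace`. -/
def IsAmbientSpace {Ω : Type*} [MeasurableSpace Ω] (P : Measure Ω)
    (𝒳 : Submodule ℝ (Ω →ₘ[P] ℝ)) [τ : TopologicalSpace 𝒳] : Prop :=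
  (𝒳 = Lp.LpSubmodule ℝ ℝ ∞ P ∧ τ = weakStarTopology P 𝒳) ∨ IsFrechetAmbientSpace P 𝒳

section Sets

variable {Ω : Type*} [MeasurableSpace Ω] {P : Measure Ω} {𝒳 : Submodule ℝ (Ω →ₘ[P] ℝ)}

/-- Acceptance sets: non-empty, strict, monotone subsets of `𝒳`. -/
structure IsAcceptanceSet (𝒜 : Set 𝒳) : Prop where
  nonempty : 𝒜.Nonempty
  ne_univ : 𝒜 ≠ Set.univ
  monotone : ∀ X ∈ 𝒜, ∀ Y : 𝒳, (X : Ω →ₘ[P] ℝ) ≤ (Y : Ω →ₘ[P] ℝ) → Y ∈ 𝒜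

/-- Surplus invariance: `X ∈ 𝒜` and `Y⁻ ≤ X⁻` imply `Y ∈ 𝒜`, where `X⁻ = max {-X, 0}`. -/
def IsSurplusInvariant (𝒜 : Set 𝒳) : Prop :=
  ∀ X ∈ 𝒜, ∀ Y : 𝒳, (Y : Ω →ₘ[P] ℝ)⁻ ≤ (X : Ω →ₘ[P] ℝ)⁻ → Y ∈ 𝒜

/-- `𝒳(A) = 1_A 𝒳`. -/
def localizedSpace (𝒳 : Submodule ℝ (Ω →ₘ[P] ℝ)) (A : Set Ω) : Set 𝒳 :=
  {Y | ∃ X : 𝒳, (Y : Ω →ₘ[P] ℝ) =ᵐ[P] A.indicator (X : Ω →ₘ[P] ℝ)}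

/-- `𝒳₊(A) = 𝒳(A) ∩ 𝒳₊`. -/
def localizedPos (𝒳 : Submodule ℝ (Ω →ₘ[P] ℝ)) (A : Set Ω) : Set 𝒳 :=
  localizedSpace 𝒳 A ∩ {X | 0 ≤ (X : Ω →ₘ[P] ℝ)}

/-- `𝒳₋(A) = 𝒳(A) ∩ 𝒳₋`. -/
def localizedNeg (𝒳 : Submodule ℝ (Ω →ₘ[P] ℝ)) (A : Set Ω) : Set 𝒳 :=
  localizedSpace 𝒳 A ∩ {X | (X : Ω →ₘ[P] ℝ) ≤ 0}

/-- Solidity in `𝒳₋`: `X ∈ 𝒟` and `X ≤ Y ≤ 0` imply `Y ∈ 𝒟`. -/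
def IsSolidNeg (𝒟 : Set 𝒳) : Prop :=
  ∀ X ∈ 𝒟, ∀ Y : 𝒳, (X : Ω →ₘ[P] ℝ) ≤ (Y : Ω →ₘ[P] ℝ) → (Y : Ω →ₘ[P] ℝ) ≤ 0 → Y ∈ 𝒟

/-- Tightness (boundedness in probability): for every `ε ∈ (0, 1)` there is `M > 0` such that
`P(-M < X < M) > ε` for all `X ∈ 𝒟`. -/
def IsTightSet (𝒟 : Set 𝒳) : Prop :=
  ∀ ε : ℝ, 0 < ε → ε < 1 → ∃ M : ℝ, 0 < M ∧ ∀ X ∈ 𝒟,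
    ε < P.real {ω | -M < (X : Ω →ₘ[P] ℝ) ω ∧ (X : Ω →ₘ[P] ℝ) ω < M}

/-- Sensitivity on `B`: every non-null measurable `E ⊆ B` admits `X ∈ 𝒟` with
`P(1_E X < 0) > 0`. -/
def IsSensitiveOn (𝒟 : Set 𝒳) (B : Set Ω) : Prop :=
  ∀ E ⊆ B, MeasurableSet E → 0 < P E →
    ∃ X ∈ 𝒟, 0 < P {ω | E.indicator (X : Ω →ₘ[P] ℝ) ω < 0}

/-- `S = S₁ ⊕ S₂ ⊕ S₃`: every element of `S` is in exactly one way a sum of elements of the three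
sets, and all such sums lie in `S`. -/
def IsDirectSum₃ {V : Type*} [Add V] (S S₁ S₂ S₃ : Set V) : Prop :=
  Set.BijOn (fun p : V × V × V => p.1 + p.2.1 + p.2.2) (S₁ ×ˢ S₂ ×ˢ S₃) S

/-- `{A, B, C}` is a measurable partition of `Ω` (with possibly empty members) with `P(C) < 1`, and
`𝒜 = 𝒳₊(A) ⊕ (𝒳₊(B) + 𝒟) ⊕ 𝒳(C)`, where `𝒟 ⊆ 𝒳₋(B)` is closed, convex, solid, tight and
sensitive on `B`. -/
structure IsDecomposition [TopologicalSpace 𝒳] (𝒜 : Set 𝒳) (A B C : Set Ω) (𝒟 : Set 𝒳) :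
    Prop where
  measurableSet_A : MeasurableSet A
  measurableSet_B : MeasurableSet B
  measurableSet_C : MeasurableSet C
  disjoint_AB : Disjoint A B
  disjoint_AC : Disjoint A C
  disjoint_BC : Disjoint B C
  union_eq : A ∪ B ∪ C = Set.univ
  measure_C_lt_one : P C < 1
  subset_neg : 𝒟 ⊆ localizedNeg 𝒳 B
  isClosed : IsClosed 𝒟
  convex : Convex ℝ 𝒟
  solid : IsSolidNeg 𝒟
  tight : IsTightSet 𝒟
  sensitive : IsSensitiveOn 𝒟 B
  directSum : IsDirectSum₃ 𝒜 (localizedPos 𝒳 A) (localizedPos 𝒳 B + 𝒟) (localizedSpace 𝒳 C)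

end Sets

/-!
The topology of `𝒳` enters only through the order: in both admissible cases, a sequence decreasing
almost surely to `Y` converges to `Y` in `𝒳`, and the half spaces `{X | s X ≤ 0 a.s. on E}` are
closed. `IsOrderAmbient` records this, together with `L^∞ ⊆ 𝒳` and stability under suprema and
indicators, and is derived in `IsAmbientSpace.isOrderAmbient`. For `σ(L^∞, L¹)` it comes from
dominated convergence and from testing against indicator functions.

**Existence.** Let `𝒜` be surplus invariant. Call a set `E` *free* if `-n 1_E ∈ 𝒜` for all `n`
(`AcceptsAllLossesOn`). By convexity and monotone closedness the free sets are stable under countable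
unions, so there is an essentially largest one, `C`. Similarly let `A`, up to a modification, be the
essentially largest set on which all members of `𝒜` are nonnegative, let `B` be the rest, and put
`𝒟 = 𝒜 ∩ 𝒳₋(B)`. Maximality of `A` gives sensitivity. Truncating at `-n` gives `𝒳(C) ⊆ 𝒜`, and
`(1 - t) d + t (z / t) ↓ d + z` gives `d + z ∈ 𝒜` for `d ∈ 𝒟`, `z ∈ 𝒳(C)`
(`add_mem_of_acceptsAllLossesOn`), from which the decomposition follows.

**Tightness.** If `𝒟` is not tight there are `X_j ∈ 𝒟` with `X_j ≤ -4^j` on sets `F_j` of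
probability at least `1 - ε`. The finite sums `∑ 2^{-(j+1)} X_j` belong to `𝒜` by convexity and
`0 ∈ 𝒜`, and they tend to `-∞` on `limsup F_j`, which is therefore free; it has probability at least
`1 - ε` and is essentially contained in `B`, against the maximality of `C`
(`acceptsAllLossesOn_of_seq`, `isTightSet_of_subset`).

**Converse and uniqueness.** A decomposition says that `X ∈ 𝒜` if and only if `X ≥ 0` on `A` and
`X ≥ d` on `B` for some `d ∈ 𝒟` (`IsDecomposition.mem_iff`). Solidity of `𝒟` then gives surplus
invariance. Moreover `C` is the essentially largest free set, by tightness, and `A` is the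
essentially largest set on which `𝒜` is nonnegative, by sensitivity, so both are determined by `𝒜`.
-/

/-! ### Order-theoretic properties of the ambient spaces -/

/-- The properties common to both kinds of ambient spaces on which the decomposition rests. The
inequalities and pointwise limits are almost sure. -/
structure IsOrderAmbient {Ω : Type*} [MeasurableSpace Ω] (P : Measure Ω)
    (𝒳 : Submodule ℝ (Ω →ₘ[P] ℝ)) [TopologicalSpace 𝒳] : Prop where
  bounded_mem : ∀ (f : Ω →ₘ[P] ℝ) (c : ℝ), (∀ᵐ ω ∂P, |f ω| ≤ c) → f ∈ 𝒳
  sup_mem : ∀ X ∈ 𝒳, ∀ Y ∈ 𝒳, X ⊔ Y ∈ 𝒳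
  indicator_mem : ∀ A : Set Ω, MeasurableSet A → ∀ X ∈ 𝒳, ∃ Y ∈ 𝒳, Y =ᵐ[P] A.indicator X
  tendsto_of_antitone : ∀ (X : ℕ → 𝒳) (Y : 𝒳),
    (∀ n, (X (n + 1) : Ω →ₘ[P] ℝ) ≤ᵐ[P] (X n : Ω →ₘ[P] ℝ)) →
    (∀ᵐ ω ∂P, Tendsto (fun n => (X n : Ω →ₘ[P] ℝ) ω) atTop (𝓝 ((Y : Ω →ₘ[P] ℝ) ω))) →
    Tendsto X atTop (𝓝 Y)
  isClosed_setOf_ae_nonpos : ∀ E : Set Ω, MeasurableSet E → ∀ s : ℝ,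
    IsClosed {X : 𝒳 | ∀ᵐ ω ∂P, ω ∈ E → s * (X : Ω →ₘ[P] ℝ) ω ≤ 0}

section Ambient

variable {Ω : Type*} [MeasurableSpace Ω] {P : Measure Ω} {𝒳 : Submodule ℝ (Ω →ₘ[P] ℝ)}

theorem mem_Lp_top_iff_ae_bound [IsFiniteMeasure P] {f : Ω →ₘ[P] ℝ} :
    f ∈ Lp ℝ ∞ P ↔ ∃ c : ℝ, ∀ᵐ ω ∂P, |f ω| ≤ c := by
  rw [Lp.mem_Lp_iff_memLp]
  constructor
  · intro h
    refine ⟨(eLpNorm f ∞ P).toReal, ?_⟩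
    have := ae_le_eLpNormEssSup (f := f) (μ := P)
    filter_upwards [this] with ω hω
    rw [← Real.norm_eq_abs, ← toReal_enorm]
    rw [eLpNorm_exponent_top]
    refine ENNReal.toReal_mono ?_ hω
    have := h.2.ne
    rwa [eLpNorm_exponent_top] at this
  · rintro ⟨c, hc⟩
    exact memLp_top_of_bound f.aestronglyMeasurable c (by simpa [Real.norm_eq_abs] using hc)

theorem isOrderAmbient_weakStar [IsProbabilityMeasure P] :
    @IsOrderAmbient Ω _ P (Lp.LpSubmodule ℝ ℝ ∞ P) (weakStarTopology P _) := by
  let := weakStarTopology P (Lp.LpSubmodule ℝ ℝ ∞ P)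
  have hmem : ∀ f : Ω →ₘ[P] ℝ,
      f ∈ Lp.LpSubmodule ℝ ℝ ∞ P ↔ ∃ c : ℝ, ∀ᵐ ω ∂P, |f ω| ≤ c :=
    fun f => mem_Lp_top_iff_ae_bound
  have hcont : ∀ Z : Lp ℝ 1 P, Continuous fun X : Lp.LpSubmodule ℝ ℝ ∞ P =>
      ∫ ω, (X : Ω →ₘ[P] ℝ) ω * (Z : Ω →ₘ[P] ℝ) ω ∂P :=
    (continuous_pi_iff (f := fun (X : Lp.LpSubmodule ℝ ℝ ∞ P) (Z : Lp ℝ 1 P) =>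
      ∫ ω, (X : Ω →ₘ[P] ℝ) ω * (Z : Ω →ₘ[P] ℝ) ω ∂P)).1 continuous_induced_dom
  constructor
  · exact fun f c h => (hmem f).2 ⟨c, h⟩
  · intro X hX Y hY
    obtain ⟨c, hc⟩ := (hmem X).1 hX
    obtain ⟨d, hd⟩ := (hmem Y).1 hY
    refine (hmem _).2 ⟨max c d, ?_⟩
    filter_upwards [hc, hd, AEEqFun.coeFn_sup X Y] with ω h1 h2 h3
    rw [h3]
    exact abs_max_le_max_abs_abs.trans (max_le_max h1 h2)
  · intro A hA X hX
    obtain ⟨c, hc⟩ := (hmem X).1 hX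
    have hm : AEStronglyMeasurable (A.indicator X) P := X.aestronglyMeasurable.indicator hA
    refine ⟨AEEqFun.mk _ hm, (hmem _).2 ⟨c, ?_⟩, AEEqFun.coeFn_mk _ hm⟩
    filter_upwards [hc, AEEqFun.coeFn_mk _ hm] with ω h1 h2
    rw [h2]
    by_cases h : ω ∈ A
    · simpa [h] using h1
    · simpa [h] using (abs_nonneg _).trans h1
  · intro X Y hX hlim
    rw [nhds_induced, tendsto_comap_iff, tendsto_pi_nhds]
    intro Z
    obtain ⟨c, hc⟩ := (hmem _).1 (X 0).2
    obtain ⟨d, hd⟩ := (hmem _).1 Y.2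
    have hZ : Integrable (Z : Ω →ₘ[P] ℝ) P := L1.integrable_coeFn Z
    refine tendsto_integral_of_dominated_convergence
      (fun ω => max c d * |(Z : Ω →ₘ[P] ℝ) ω|) (fun n => ?_) (hZ.abs.const_mul _) (fun n => ?_) ?_
    · exact (AEEqFun.aestronglyMeasurable _).mul hZ.1
    · filter_upwards [ae_all_iff.2 hX, hlim, hc, hd] with ω h1 h2 h3 h4
      have hanti : Antitone fun n => (X n : Ω →ₘ[P] ℝ) ω := antitone_nat_of_succ_le h1
      rw [norm_mul]
      refine mul_le_mul_of_nonneg_right ?_ (norm_nonneg _)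
      have := hanti.le_of_tendsto h2 n
      have h0 := hanti (Nat.zero_le n)
      simp only at h0
      rw [Real.norm_eq_abs, abs_le]
      constructor
      · linarith [neg_abs_le ((Y : Ω →ₘ[P] ℝ) ω), le_max_right c d]
      · linarith [le_abs_self ((X 0 : Ω →ₘ[P] ℝ) ω), le_max_left c d]
    · filter_upwards [hlim] with ω h
      exact h.mul_const _
  · intro E hE s
    -- The set is cut out by the functionals `X ↦ E[s X 1_F]` with measurable `F ⊆ E`.
    have key : {X : Lp.LpSubmodule ℝ ℝ ∞ P | ∀ᵐ ω ∂P, ω ∈ E → s * (X : Ω →ₘ[P] ℝ) ω ≤ 0} =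
        ⋂ F : {F : Set Ω // MeasurableSet F ∧ F ⊆ E}, {X : Lp.LpSubmodule ℝ ℝ ∞ P |
          s * ∫ ω, (X : Ω →ₘ[P] ℝ) ω *
            (indicatorConstLp 1 F.2.1 (measure_ne_top P F.1) (1 : ℝ) : Ω →ₘ[P] ℝ) ω ∂P ≤ 0} := by
      have hint : ∀ (X : Ω →ₘ[P] ℝ) (F : Set Ω) (hF : MeasurableSet F), s * ∫ ω, X ω *
            (indicatorConstLp 1 hF (measure_ne_top P F) (1 : ℝ) : Ω →ₘ[P] ℝ) ω ∂P =
            ∫ ω in F, s * X ω ∂P := by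
        intro X F hF
        rw [← integral_const_mul, ← integral_indicator hF]
        refine integral_congr_ae ?_
        filter_upwards [indicatorConstLp_coeFn (p := 1) (hs := hF) (hμs := measure_ne_top P F)
          (c := (1 : ℝ))] with ω h
        rw [h]
        by_cases hω : ω ∈ F <;> simp [hω]
      ext X
      simp only [Set.mem_ofPred_eq, Set.mem_iInter, hint]
      constructor
      · rintro h ⟨F, hF, hFE⟩
        refine setIntegral_nonpos_of_ae_restrict ?_
        rw [EventuallyLE, ae_restrict_iff' hF]
        filter_upwards [h] with ω h hω using h (hFE hω)
      · intro h
        obtain ⟨c, hc⟩ := (hmem _).1 X.2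
        have hi : Integrable (fun ω => s * (X : Ω →ₘ[P] ℝ) ω) P :=
          (Integrable.of_bound (AEEqFun.aestronglyMeasurable _) c
            (by simpa [Real.norm_eq_abs] using hc)).const_mul s
        have h0 := ae_nonneg_restrict_of_forall_setIntegral_nonneg_inter
          (μ := P) (f := fun ω => -(s * (X : Ω →ₘ[P] ℝ) ω)) (t := E) hi.neg.integrableOn
          (fun F hF _ => by
            have := h ⟨F ∩ E, hF.inter hE, Set.inter_subset_right⟩
            rw [integral_neg]
            linarith)
        rw [EventuallyLE, ae_restrict_iff' hE] at h0
        filter_upwards [h0] with ω h1 h2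
        have := h1 h2
        simp only [Pi.zero_apply] at this
        linarith
    rw [key]
    exact isClosed_iInter fun F => isClosed_le (continuous_const.mul (hcont _)) continuous_const

/-- If `Y ≤ 0` on `E`, the distance `E[min (|X - Y|, 1)]` is at least `E[1_E min (X⁺, 1)]`. -/
theorem isClosed_setOf_ae_nonpos_convInProb {E : Set Ω} (hE : MeasurableSet E) :
    @IsClosed _ (convInProbTopology P) {X : Ω →ₘ[P] ℝ | ∀ᵐ ω ∂P, ω ∈ E → X ω ≤ 0} := by
  let := convInProbPseudoEMetric P
  refine isClosed_of_closure_subset fun X hX => ?_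
  rw [EMetric.mem_closure_iff] at hX
  have hm : AEMeasurable (fun ω => min (ENNReal.ofReal (X ω)) 1) (P.restrict E) :=
    (X.stronglyMeasurable.measurable.ennreal_ofReal.min measurable_const).aemeasurable
  have h0 : ∫⁻ ω in E, min (ENNReal.ofReal (X ω)) 1 ∂P = 0 := by
    refine le_antisymm (le_of_forall_gt fun ε hε => ?_) bot_le
    obtain ⟨Y, hY, hd⟩ := hX ε hε
    refine lt_of_le_of_lt ?_ hd
    refine le_trans ?_ (setLIntegral_le_lintegral E _)
    refine lintegral_mono_ae ?_
    rw [ae_restrict_iff' hE]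
    filter_upwards [hY] with ω h hω
    refine min_le_min_right _ ?_
    rw [edist_dist, Real.dist_eq]
    exact ENNReal.ofReal_le_ofReal ((by linarith [h hω] : X ω ≤ X ω - Y ω).trans (le_abs_self _))
  rw [lintegral_eq_zero_iff' hm, EventuallyEq, ae_restrict_iff' hE] at h0
  filter_upwards [h0] with ω h hω
  have := h hω
  rcases min_choice (ENNReal.ofReal (X ω)) 1 with h' | h'
  · rw [h'] at this
    exact ENNReal.ofReal_eq_zero.1 this
  · rw [h'] at this
    simp at this

theorem IsFrechetAmbientSpace.isOrderAmbient [IsProbabilityMeasure P] [TopologicalSpace 𝒳]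
    (h : IsFrechetAmbientSpace P 𝒳) : IsOrderAmbient P 𝒳 := by
  have := h.isTopologicalAddGroup
  have := h.continuousSMul
  constructor
  · intro f c hf
    obtain ⟨h1, -⟩ := h.embedding_Linfty
    exact h1 f (mem_Lp_top_iff_ae_bound.2 ⟨c, hf⟩)
  · exact h.sup_mem
  · exact h.localization
  · intro X Y hX hlim
    have hsub : ∀ n, ((X n - Y : 𝒳) : Ω →ₘ[P] ℝ) =ᵐ[P] X n - Y := fun n =>
      AEEqFun.coeFn_sub _ _
    have := h.sigmaLebesgue (fun n => X n - Y) (antitone_nat_of_succ_le fun n => ?_) ?_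
    · simpa using this.add_const Y
    · refine AEEqFun.coeFn_le.1 ?_
      filter_upwards [hsub n, hsub (n + 1), hX n] with ω h1 h2 h3
      rw [h1, h2]
      exact sub_le_sub_right h3 _
    · filter_upwards [ae_all_iff.2 hsub, hlim] with ω h1 h2
      simp only [h1, Pi.sub_apply]
      simpa using h2.sub_const ((Y : Ω →ₘ[P] ℝ) ω)
  · intro E hE s
    have h1 : IsClosed {X : 𝒳 | ∀ᵐ ω ∂P, ω ∈ E → (X : Ω →ₘ[P] ℝ) ω ≤ 0} :=
      @IsClosed.preimage _ _ _ (convInProbTopology P) _ h.continuous_toL0 _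
        (isClosed_setOf_ae_nonpos_convInProb hE)
    have h2 := h1.preimage (continuous_const_smul s : Continuous fun X : 𝒳 => s • X)
    convert h2 using 1
    ext X
    have hs : ((s • X : 𝒳) : Ω →ₘ[P] ℝ) =ᵐ[P] s • (X : Ω →ₘ[P] ℝ) := AEEqFun.coeFn_smul _ _
    simp only [Set.mem_ofPred_eq, Set.mem_preimage]
    refine eventually_congr ?_
    filter_upwards [hs] with ω h
    rw [h, Pi.smul_apply, smul_eq_mul]

theorem IsAmbientSpace.isOrderAmbient [IsProbabilityMeasure P] [τ : TopologicalSpace 𝒳]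
    (h : IsAmbientSpace P 𝒳) : IsOrderAmbient P 𝒳 := by
  rcases h with ⟨rfl, rfl⟩ | h
  · exact isOrderAmbient_weakStar
  · exact h.isOrderAmbient

end Ambient

section Sets

variable {Ω : Type*} [MeasurableSpace Ω] {P : Measure Ω} {𝒳 : Submodule ℝ (Ω →ₘ[P] ℝ)}

/-! ### Essentially largest sets -/

/-- Exhaustion: a class of measurable sets that is closed under countable unions has a member that
contains every other member up to a null set. -/
theorem exists_essentially_largest_set [IsFiniteMeasure P] {p : Set Ω → Prop} (hempty : p ∅)
    (hunion : ∀ E : ℕ → Set Ω, (∀ n, MeasurableSet (E n)) → (∀ n, p (E n)) → p (⋃ n, E n)) :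
    ∃ C, MeasurableSet C ∧ p C ∧ ∀ E, MeasurableSet E → p E → P (E \ C) = 0 := by
  set S : Set ℝ≥0∞ := P '' {E | MeasurableSet E ∧ p E}
  have hne : S.Nonempty := ⟨_, ∅, ⟨MeasurableSet.empty, hempty⟩, rfl⟩
  obtain ⟨u, -, hu, huS⟩ := exists_seq_tendsto_sSup hne (OrderTop.bddAbove S)
  choose E hE hPE using huS
  have hCm : MeasurableSet (⋃ n, E n) := MeasurableSet.iUnion fun n => (hE n).1
  have hCp : p (⋃ n, E n) := hunion E (fun n => (hE n).1) fun n => (hE n).2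
  refine ⟨⋃ n, E n, hCm, hCp, fun F hF hpF => ?_⟩
  have hsup : sSup S ≤ P (⋃ n, E n) := le_of_tendsto' hu fun n => by
    rw [← hPE n]
    exact measure_mono (Set.subset_iUnion E n)
  have hp : p (F ∪ ⋃ n, E n) := by
    have := hunion (fun n => Nat.casesOn n F E) (fun n => by cases n <;> simp [hF, (hE _).1])
      (fun n => by cases n <;> simp [hpF, (hE _).2])
    rwa [← Set.union_iUnion_nat_succ] at this
  have hmem : P (F ∪ ⋃ n, E n) ∈ P '' {E | MeasurableSet E ∧ p E} :=
    Set.mem_image_of_mem P (Set.mem_ofPred_eq.mpr ⟨hF.union hCm, hp⟩)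
  have hle : P (F ∪ ⋃ n, E n) ≤ P (⋃ n, E n) :=
    (le_sSup hmem).trans hsup
  rw [← Set.sdiff_union_self, measure_union Set.disjoint_sdiff_left hCm] at hle
  by_contra h0
  exact absurd hle (not_le.2 (by
    rw [add_comm]
    exact ENNReal.lt_add_right (measure_ne_top _ _) h0))

/-! ### Elements of the ambient space -/

theorem ae_coe_add (X Y : 𝒳) : ∀ᵐ ω ∂P, (X + Y).1 ω = X.1 ω + Y.1 ω := AEEqFun.coeFn_add _ _

theorem ae_coe_sub (X Y : 𝒳) : ∀ᵐ ω ∂P, (X - Y).1 ω = X.1 ω - Y.1 ω := AEEqFun.coeFn_sub _ _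

theorem ae_coe_smul (c : ℝ) (X : 𝒳) : ∀ᵐ ω ∂P, (c • X).1 ω = c * X.1 ω := AEEqFun.coeFn_smul _ _

theorem ae_coe_zero : ∀ᵐ ω ∂P, (0 : 𝒳).1 ω = 0 := AEEqFun.coeFn_zero

theorem ae_negPart (X : Ω →ₘ[P] ℝ) : ∀ᵐ ω ∂P, X⁻ ω = max (-X ω) 0 := by
  rw [negPart_def]
  filter_upwards [AEEqFun.coeFn_sup (-X) 0, AEEqFun.coeFn_neg X,
    AEEqFun.coeFn_zero (μ := P) (α := Ω) (β := ℝ)] with ω h1 h2 h3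
  rw [h1, h2, h3]
  rfl

theorem subtype_ext_ae {X Y : 𝒳} (h : ∀ᵐ ω ∂P, X.1 ω = Y.1 ω) : X = Y :=
  Subtype.ext (AEEqFun.ext h)

theorem mem_localizedSpace_iff {A : Set Ω} {Y : 𝒳} :
    Y ∈ localizedSpace 𝒳 A ↔ ∀ᵐ ω ∂P, ω ∉ A → Y.1 ω = 0 := by
  constructor
  · rintro ⟨X, hX⟩
    filter_upwards [hX] with ω h hω
    rw [h, Set.indicator_of_notMem hω]
  · intro h
    refine ⟨Y, ?_⟩
    filter_upwards [h] with ω h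
    by_cases hω : ω ∈ A
    · rw [Set.indicator_of_mem hω]
    · rw [Set.indicator_of_notMem hω, h hω]

theorem mem_localizedPos_iff {A : Set Ω} {Y : 𝒳} :
    Y ∈ localizedPos 𝒳 A ↔ (∀ᵐ ω ∂P, ω ∉ A → Y.1 ω = 0) ∧ ∀ᵐ ω ∂P, 0 ≤ Y.1 ω := by
  refine and_congr mem_localizedSpace_iff (AEEqFun.coeFn_le.symm.trans (eventually_congr ?_))
  filter_upwards [AEEqFun.coeFn_zero (μ := P) (α := Ω) (β := ℝ)] with ω h
  rw [h, Pi.zero_apply]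

theorem le_zero_iff_ae {Y : 𝒳} : Y.1 ≤ 0 ↔ ∀ᵐ ω ∂P, Y.1 ω ≤ 0 := by
  refine AEEqFun.coeFn_le.symm.trans (eventually_congr ?_)
  filter_upwards [AEEqFun.coeFn_zero (μ := P) (α := Ω) (β := ℝ)] with ω h
  rw [h, Pi.zero_apply]

theorem mem_localizedNeg_iff {A : Set Ω} {Y : 𝒳} :
    Y ∈ localizedNeg 𝒳 A ↔ (∀ᵐ ω ∂P, ω ∉ A → Y.1 ω = 0) ∧ ∀ᵐ ω ∂P, Y.1 ω ≤ 0 :=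
  and_congr mem_localizedSpace_iff le_zero_iff_ae

variable [TopologicalSpace 𝒳]

namespace IsOrderAmbient

theorem exists_of_bound (h : IsOrderAmbient P 𝒳) {f : Ω → ℝ} (hf : AEStronglyMeasurable f P)
    {c : ℝ} (hc : ∀ ω, |f ω| ≤ c) : ∃ X : 𝒳, X.1 =ᵐ[P] f := by
  refine ⟨⟨AEEqFun.mk f hf, h.bounded_mem _ c ?_⟩, AEEqFun.coeFn_mk f hf⟩
  filter_upwards [AEEqFun.coeFn_mk f hf] with ω h1
  rw [h1]
  exact hc ω

theorem exists_indicator_const (h : IsOrderAmbient P 𝒳) {E : Set Ω} (hE : MeasurableSet E)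
    (c : ℝ) : ∃ X : 𝒳, X.1 =ᵐ[P] E.indicator fun _ => c := by
  refine h.exists_of_bound (c := |c|) (aestronglyMeasurable_const.indicator hE) fun ω => ?_
  by_cases hω : ω ∈ E <;> simp [hω]

theorem exists_indicator (h : IsOrderAmbient P 𝒳) {E : Set Ω} (hE : MeasurableSet E) (X : 𝒳) :
    ∃ Y : 𝒳, Y.1 =ᵐ[P] E.indicator X.1 := by
  obtain ⟨Y, hY, hYX⟩ := h.indicator_mem E hE X.1 X.2
  exact ⟨⟨Y, hY⟩, hYX⟩

theorem exists_max (h : IsOrderAmbient P 𝒳) (X Y : 𝒳) :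
    ∃ Z : 𝒳, ∀ᵐ ω ∂P, Z.1 ω = max (X.1 ω) (Y.1 ω) :=
  ⟨⟨X.1 ⊔ Y.1, h.sup_mem _ X.2 _ Y.2⟩, AEEqFun.coeFn_sup _ _⟩

theorem exists_min_zero (h : IsOrderAmbient P 𝒳) (X : 𝒳) :
    ∃ Z : 𝒳, ∀ᵐ ω ∂P, Z.1 ω = min (X.1 ω) 0 := by
  obtain ⟨Z, hZ⟩ := h.exists_max ((-1 : ℝ) • X) 0
  refine ⟨(-1 : ℝ) • Z, ?_⟩
  filter_upwards [hZ, ae_coe_smul (-1) Z, ae_coe_smul (-1) X, ae_coe_zero (𝒳 := 𝒳)]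
    with ω h1 h2 h3 h4
  rw [h2, h1, h3, h4]
  rcases le_total (X.1 ω) 0 with h | h
  · rw [min_eq_left h, max_eq_left (by linarith)]; ring
  · rw [min_eq_right h, max_eq_right (by linarith)]; ring

end IsOrderAmbient

/-! ### The direct sum as a membership criterion -/

/-- The set `𝒳₊(A) ⊕ (𝒳₊(B) + 𝒟) ⊕ 𝒳(C)`: its elements are nonnegative on `A`, dominate an element
of `𝒟` on `B`, and are unrestricted on `C`. -/
theorem isDirectSum₃_setOf (h : IsOrderAmbient P 𝒳) {A B C : Set Ω} {𝒟 : Set 𝒳}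
    (hA : MeasurableSet A) (hB : MeasurableSet B) (hC : MeasurableSet C) (hAB : Disjoint A B)
    (hAC : Disjoint A C) (hBC : Disjoint B C) (hABC : A ∪ B ∪ C = Set.univ)
    (h𝒟 : 𝒟 ⊆ localizedNeg 𝒳 B) :
    IsDirectSum₃ {X : 𝒳 | (∀ᵐ ω ∂P, ω ∈ A → 0 ≤ X.1 ω) ∧ ∃ d ∈ 𝒟, ∀ᵐ ω ∂P, ω ∈ B → d.1 ω ≤ X.1 ω}
      (localizedPos 𝒳 A) (localizedPos 𝒳 B + 𝒟) (localizedSpace 𝒳 C) := by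
  have hcases : ∀ ω, (ω ∈ A ∧ ω ∉ B ∧ ω ∉ C) ∨ (ω ∉ A ∧ ω ∈ B ∧ ω ∉ C) ∨
      (ω ∉ A ∧ ω ∉ B ∧ ω ∈ C) := by
    intro ω
    have h1 : ω ∈ A ∪ B ∪ C := hABC ▸ Set.mem_univ ω
    have h2 : ω ∈ A → ω ∉ B := fun hx => Set.disjoint_left.1 hAB hx
    have h3 : ω ∈ A → ω ∉ C := fun hx => Set.disjoint_left.1 hAC hx
    have h4 : ω ∈ B → ω ∉ C := fun hx => Set.disjoint_left.1 hBC hx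
    simp only [Set.mem_union] at h1
    tauto
  have hmid : ∀ Y ∈ localizedPos 𝒳 B + 𝒟, ∀ᵐ ω ∂P, ω ∉ B → Y.1 ω = 0 := by
    rintro _ ⟨b, hb, d, hd, rfl⟩
    filter_upwards [(mem_localizedPos_iff.1 hb).1, (mem_localizedNeg_iff.1 (h𝒟 hd)).1,
      ae_coe_add b d] with ω h1 h2 h3 hω
    rw [h3, h1 hω, h2 hω, add_zero]
  have hsum : ∀ X Y Z : 𝒳, ∀ᵐ ω ∂P, (X + Y + Z).1 ω = X.1 ω + Y.1 ω + Z.1 ω := by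
    intro X Y Z
    filter_upwards [ae_coe_add (X + Y) Z, ae_coe_add X Y] with ω h1 h2
    rw [h1, h2]
  refine ⟨?_, ?_, ?_⟩
  · rintro ⟨x, y, z⟩ ⟨hx, hy, hz⟩
    have hy0 := hmid y hy
    obtain ⟨b, hb, d, hd, rfl⟩ := hy
    rw [mem_localizedPos_iff] at hx hb
    simp only [mem_localizedSpace_iff] at hz
    simp only at hx hy0
    refine ⟨?_, d, hd, ?_⟩
    · filter_upwards [hsum x (b + d) z, hx.2, hy0, hz] with ω h1 h2 h3 h4 hω
      rcases hcases ω with h | h | h <;> grind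
    · filter_upwards [hsum x (b + d) z, hx.1, hb.2, ae_coe_add b d, hz] with ω h1 h2 h3 h4 h5 hω
      rcases hcases ω with h | h | h <;> grind
  · rintro ⟨x, y, z⟩ ⟨hx, hy, hz⟩ ⟨x', y', z'⟩ ⟨hx', hy', hz'⟩ heq
    have hy := hmid y hy
    have hy' := hmid y' hy'
    rw [mem_localizedPos_iff] at hx hx'
    simp only [mem_localizedSpace_iff] at hz hz'
    simp only at hx hx' hy hy' heq
    have key : ∀ᵐ ω ∂P, x.1 ω = x'.1 ω ∧ y.1 ω = y'.1 ω ∧ z.1 ω = z'.1 ω := by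
      have h1 := hsum x y z
      rw [heq] at h1
      filter_upwards [h1, hsum x' y' z', hx.1, hx'.1, hy, hy', hz, hz']
        with ω h1 h2 h3 h4 h5 h6 h7 h8
      rcases hcases ω with h | h | h <;> grind
    rw [subtype_ext_ae (key.mono fun ω h => h.1), subtype_ext_ae (key.mono fun ω h => h.2.1),
      subtype_ext_ae (key.mono fun ω h => h.2.2)]
  · rintro X ⟨hXA, d, hd, hXB⟩
    obtain ⟨x, hx⟩ := h.exists_indicator hA X
    obtain ⟨y, hy⟩ := h.exists_indicator hB X
    obtain ⟨z, hz⟩ := h.exists_indicator hC X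
    have hd' := (mem_localizedNeg_iff.1 (h𝒟 hd)).1
    refine ⟨(x, y, z), ⟨mem_localizedPos_iff.2 ⟨?_, ?_⟩,
      ⟨y - d, mem_localizedPos_iff.2 ⟨?_, ?_⟩, d, hd, sub_add_cancel y d⟩,
      mem_localizedSpace_iff.2 ?_⟩, subtype_ext_ae ?_⟩
    · filter_upwards [hx] with ω h1 hω
      rw [h1, Set.indicator_of_notMem hω]
    · filter_upwards [hx, hXA] with ω h1 h2
      rw [h1]
      exact Set.indicator_apply_nonneg h2
    · filter_upwards [hy, hd', ae_coe_sub y d] with ω h1 h2 h3 hω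
      rw [h3, h1, Set.indicator_of_notMem hω, h2 hω, sub_zero]
    · filter_upwards [hy, hd', ae_coe_sub y d, hXB] with ω h1 h2 h3 h4
      rw [h3, h1]
      by_cases hω : ω ∈ B
      · rw [Set.indicator_of_mem hω]
        exact sub_nonneg.2 (h4 hω)
      · rw [Set.indicator_of_notMem hω, h2 hω, sub_zero]
    · filter_upwards [hz] with ω h1 hω
      rw [h1, Set.indicator_of_notMem hω]
    · filter_upwards [hx, hy, hz, hsum x y z] with ω h1 h2 h3 h4
      rw [h4, h1, h2, h3]
      rcases hcases ω with h | h | h <;> simp [h]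

theorem IsDecomposition.mem_iff (h : IsOrderAmbient P 𝒳) {A B C : Set Ω} {𝒜 𝒟 : Set 𝒳}
    (hD : IsDecomposition 𝒜 A B C 𝒟) {X : 𝒳} :
    X ∈ 𝒜 ↔ (∀ᵐ ω ∂P, ω ∈ A → 0 ≤ X.1 ω) ∧ ∃ d ∈ 𝒟, ∀ᵐ ω ∂P, ω ∈ B → d.1 ω ≤ X.1 ω := by
  have h1 := (isDirectSum₃_setOf h hD.measurableSet_A hD.measurableSet_B hD.measurableSet_C
    hD.disjoint_AB hD.disjoint_AC hD.disjoint_BC hD.union_eq hD.subset_neg).image_eq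
  rw [hD.directSum.image_eq] at h1
  rw [h1]
  rfl

theorem IsDecomposition.isSurplusInvariant (h : IsOrderAmbient P 𝒳) {A B C : Set Ω}
    {𝒜 𝒟 : Set 𝒳} (hD : IsDecomposition 𝒜 A B C 𝒟) : IsSurplusInvariant 𝒜 := by
  intro X hX Y hYX
  obtain ⟨hXA, d, hd, hXB⟩ := (hD.mem_iff h).1 hX
  have hneg : ∀ᵐ ω ∂P, max (-Y.1 ω) 0 ≤ max (-X.1 ω) 0 := by
    filter_upwards [AEEqFun.coeFn_le.2 hYX, ae_negPart Y.1, ae_negPart X.1] with ω h1 h2 h3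
    rwa [h2, h3] at h1
  obtain ⟨hd0, hdneg⟩ := mem_localizedNeg_iff.1 (hD.subset_neg hd)
  obtain ⟨Z, hZ⟩ := h.exists_indicator hD.measurableSet_B Y
  obtain ⟨W, hW⟩ := h.exists_min_zero Z
  refine (hD.mem_iff h).2 ⟨?_, W, hD.solid d hd W (AEEqFun.coeFn_le.1 ?_) (le_zero_iff_ae.2 ?_), ?_⟩
  · filter_upwards [hneg, hXA] with ω h1 h2 hω
    rw [max_eq_right (neg_nonpos.2 (h2 hω))] at h1
    linarith [le_max_left (-Y.1 ω) 0]
  · filter_upwards [hneg, hXB, hd0, hdneg, hZ, hW] with ω h1 h2 h3 h4 h5 h6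
    rw [h6, h5]
    refine le_min ?_ h4
    by_cases hω : ω ∈ B
    · rw [Set.indicator_of_mem hω]
      have := h1.trans (max_le (by linarith [h2 hω]) (by linarith) : _ ≤ -d.1 ω)
      linarith [le_max_left (-Y.1 ω) 0]
    · rw [Set.indicator_of_notMem hω, h3 hω]
  · filter_upwards [hW] with ω h1
    rw [h1]
    exact min_le_right _ _
  · filter_upwards [hW, hZ] with ω h1 h2 hω
    rw [h1, h2, Set.indicator_of_mem hω]
    exact min_le_left _ _

end Sets

section Sets

variable {Ω : Type*} [MeasurableSpace Ω] {P : Measure Ω} {𝒳 : Submodule ℝ (Ω →ₘ[P] ℝ)}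

/-! ### Sets on which arbitrarily large losses are accepted -/

theorem IsAcceptanceSet.mem_of_ae_le {𝒜 : Set 𝒳} (h𝒜 : IsAcceptanceSet 𝒜) {X Y : 𝒳} (hX : X ∈ 𝒜)
    (hXY : ∀ᵐ ω ∂P, X.1 ω ≤ Y.1 ω) : Y ∈ 𝒜 :=
  h𝒜.monotone X hX Y (AEEqFun.coeFn_le.1 hXY)

/-- Surplus invariance pointwise: wherever `Y` is not nonnegative, it has to dominate `X`. -/
theorem IsSurplusInvariant.mem_of_ae {𝒜 : Set 𝒳} (hs : IsSurplusInvariant 𝒜) {X Y : 𝒳}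
    (hX : X ∈ 𝒜) (hXY : ∀ᵐ ω ∂P, 0 ≤ Y.1 ω ∨ X.1 ω ≤ Y.1 ω) : Y ∈ 𝒜 := by
  refine hs X hX Y (AEEqFun.coeFn_le.1 ?_)
  filter_upwards [hXY, ae_negPart Y.1, ae_negPart X.1] with ω h1 h2 h3
  rw [h2, h3]
  rcases h1 with h | h
  · rw [max_eq_right (neg_nonpos.2 h)]
    exact le_max_right _ _
  · exact max_le_max_right _ (neg_le_neg h)

theorem IsSurplusInvariant.zero_mem {𝒜 : Set 𝒳} (hs : IsSurplusInvariant 𝒜)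
    (h𝒜 : IsAcceptanceSet 𝒜) : 0 ∈ 𝒜 := by
  obtain ⟨X, hX⟩ := h𝒜.nonempty
  refine hs.mem_of_ae hX ?_
  filter_upwards [ae_coe_zero (𝒳 := 𝒳)] with ω h
  exact Or.inl h.ge

/-- The set `E` is free: `-n 1_E` is acceptable for every `n`. The position is given as a member of
`𝒜` that agrees almost surely with the indicator function. -/
def AcceptsAllLossesOn (𝒜 : Set 𝒳) (E : Set Ω) : Prop :=
  ∀ n : ℕ, ∃ X ∈ 𝒜, X.1 =ᵐ[P] E.indicator fun _ => -(n : ℝ)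

theorem AcceptsAllLossesOn.union [TopologicalSpace 𝒳] (h : IsOrderAmbient P 𝒳) {𝒜 : Set 𝒳}
    (h𝒜 : IsAcceptanceSet 𝒜) (hconv : Convex ℝ 𝒜) {E F : Set Ω} (hE : MeasurableSet E)
    (hF : MeasurableSet F) (hpE : AcceptsAllLossesOn 𝒜 E) (hpF : AcceptsAllLossesOn 𝒜 F) :
    AcceptsAllLossesOn 𝒜 (E ∪ F) := by
  intro n
  obtain ⟨X, hX, hXE⟩ := hpE (2 * n)
  obtain ⟨Y, hY, hYF⟩ := hpF (2 * n)
  obtain ⟨Z, hZ⟩ := h.exists_indicator_const (hE.union hF) (-(n : ℝ))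
  have hXY : (1 / 2 : ℝ) • X + (1 / 2 : ℝ) • Y ∈ 𝒜 :=
    hconv hX hY (by norm_num) (by norm_num) (by norm_num)
  refine ⟨Z, h𝒜.mem_of_ae_le hXY ?_, hZ⟩
  filter_upwards [hXE, hYF, hZ, ae_coe_add ((1 / 2 : ℝ) • X) ((1 / 2 : ℝ) • Y),
    ae_coe_smul (1 / 2) X, ae_coe_smul (1 / 2) Y] with ω h1 h2 h3 h4 h5 h6
  rw [h4, h5, h6, h1, h2, h3]
  by_cases h7 : ω ∈ E <;> by_cases h8 : ω ∈ F <;> simp [h7, h8]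

/-- The partial sums `∑_{j < m} 2^{-(j+1)} X j` of nonpositive members of `𝒜` lie in `𝒜`, as the
weights add up to less than one and `0 ∈ 𝒜`; each is dominated by all of its terms. -/
theorem exists_mem_le_of_seq {𝒜 : Set 𝒳} (h0 : 0 ∈ 𝒜) (hconv : Convex ℝ 𝒜) (m : ℕ) :
    ∀ X : ℕ → 𝒳, (∀ j, X j ∈ 𝒜) → (∀ j, ∀ᵐ ω ∂P, (X j).1 ω ≤ 0) →
      ∃ S ∈ 𝒜, ∀ᵐ ω ∂P, S.1 ω ≤ 0 ∧ ∀ j < m, S.1 ω ≤ (1 / 2) ^ (j + 1) * (X j).1 ω := by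
  induction m with
  | zero =>
    intro X _ _
    refine ⟨0, h0, ?_⟩
    filter_upwards [ae_coe_zero (𝒳 := 𝒳)] with ω h
    exact ⟨h.le, fun j hj => absurd hj (Nat.not_lt_zero j)⟩
  | succ m ih =>
    intro X hX hX0
    obtain ⟨S, hS, hSX⟩ := ih (fun j => X (j + 1)) (fun j => hX _) (fun j => hX0 _)
    refine ⟨(1 / 2 : ℝ) • X 0 + (1 / 2 : ℝ) • S,
      hconv (hX 0) hS (by norm_num) (by norm_num) (by norm_num), ?_⟩
    filter_upwards [hSX, hX0 0, ae_coe_add ((1 / 2 : ℝ) • X 0) ((1 / 2 : ℝ) • S),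
      ae_coe_smul (1 / 2) (X 0), ae_coe_smul (1 / 2) S] with ω h1 h2 h3 h4 h5
    rw [h3, h4, h5]
    refine ⟨by linarith [h1.1], fun j hj => ?_⟩
    cases j with
    | zero => norm_num; linarith [h1.1]
    | succ j =>
      have := h1.2 j (Nat.lt_of_succ_lt_succ hj)
      rw [pow_succ' (1 / 2 : ℝ) (j + 1), mul_assoc]
      linarith

variable [TopologicalSpace 𝒳]

theorem IsOrderAmbient.mem_of_antitone (h : IsOrderAmbient P 𝒳) {𝒜 : Set 𝒳} (hcl : IsClosed 𝒜)
    {X : ℕ → 𝒳} {Y : 𝒳} (hX : ∀ n, X n ∈ 𝒜) (hanti : ∀ᵐ ω ∂P, Antitone fun n => (X n).1 ω)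
    (hlim : ∀ᵐ ω ∂P, Tendsto (fun n => (X n).1 ω) atTop (𝓝 (Y.1 ω))) : Y ∈ 𝒜 :=
  hcl.mem_of_tendsto (h.tendsto_of_antitone X Y
    (fun n => hanti.mono fun _ hω => hω n.le_succ) hlim) (Eventually.of_forall hX)

/-- If `-c 1_{E m}` is acceptable along an increasing sequence of sets, so is its decreasing limit. -/
theorem exists_mem_iUnion_of_monotone (h : IsOrderAmbient P 𝒳) {𝒜 : Set 𝒳} (hcl : IsClosed 𝒜)
    {E : ℕ → Set Ω} (hE : ∀ m, MeasurableSet (E m)) (hmono : Monotone E) {c : ℝ} (hc : 0 ≤ c)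
    (hmem : ∀ m, ∃ X ∈ 𝒜, X.1 =ᵐ[P] (E m).indicator fun _ => -c) :
    ∃ X ∈ 𝒜, X.1 =ᵐ[P] (⋃ m, E m).indicator fun _ => -c := by
  choose X hX hXE using hmem
  obtain ⟨Y, hY⟩ := h.exists_indicator_const (MeasurableSet.iUnion hE) (-c)
  refine ⟨Y, h.mem_of_antitone hcl hX ?_ ?_, hY⟩
  · filter_upwards [ae_all_iff.2 hXE] with ω h1 m n hmn
    simp only [h1]
    by_cases hω : ω ∈ E m
    · rw [Set.indicator_of_mem hω, Set.indicator_of_mem (hmono hmn hω)]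
    · rw [Set.indicator_of_notMem hω]
      exact Set.indicator_apply_nonpos fun _ => neg_nonpos.2 hc
  · filter_upwards [ae_all_iff.2 hXE, hY] with ω h1 h2
    simp only [h1, h2]
    exact hmono.tendsto_indicator E _ ω |>.mono_right (pure_le_nhds _)

theorem AcceptsAllLossesOn.iUnion (h : IsOrderAmbient P 𝒳) {𝒜 : Set 𝒳} (h𝒜 : IsAcceptanceSet 𝒜)
    (hcl : IsClosed 𝒜) (hconv : Convex ℝ 𝒜) {E : ℕ → Set Ω} (hE : ∀ m, MeasurableSet (E m))
    (hp : ∀ m, AcceptsAllLossesOn 𝒜 (E m)) : AcceptsAllLossesOn 𝒜 (⋃ m, E m) := by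
  have hmeas : ∀ m, MeasurableSet (Set.accumulate E m) := fun m =>
    MeasurableSet.biUnion (Set.to_countable _) fun i _ => hE i
  have hacc : ∀ m, AcceptsAllLossesOn 𝒜 (Set.accumulate E m) := by
    intro m
    induction m with
    | zero => simpa using hp 0
    | succ m ih =>
      rw [Set.accumulate_succ]
      exact ih.union h h𝒜 hconv (hmeas m) (hE _) (hp _)
  intro n
  rw [← Set.iUnion_accumulate]
  exact exists_mem_iUnion_of_monotone h hcl hmeas Set.monotone_accumulate n.cast_nonneg
    fun m => hacc m n

theorem AcceptsAllLossesOn.localizedSpace_subset (h : IsOrderAmbient P 𝒳) {𝒜 : Set 𝒳}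
    (h𝒜 : IsAcceptanceSet 𝒜) (hcl : IsClosed 𝒜) {C : Set Ω} (hC : AcceptsAllLossesOn 𝒜 C) :
    localizedSpace 𝒳 C ⊆ 𝒜 := by
  intro X hX
  rw [mem_localizedSpace_iff] at hX
  choose Y hY hYC using hC
  choose Z hZ using fun n => h.exists_max X (Y n)
  refine h.mem_of_antitone hcl (X := Z) (fun n => h𝒜.mem_of_ae_le (hY n) ?_) ?_ ?_
  · filter_upwards [hZ n] with ω h1
    rw [h1]
    exact le_max_right _ _
  · filter_upwards [ae_all_iff.2 hZ, ae_all_iff.2 hYC] with ω h1 h2 m n hmn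
    simp only [h1, h2]
    refine max_le_max_left _ ?_
    by_cases hω : ω ∈ C
    · simpa [hω] using hmn
    · simp [hω]
  · filter_upwards [ae_all_iff.2 hZ, ae_all_iff.2 hYC, hX] with ω h1 h2 h3
    simp only [h1, h2]
    refine tendsto_const_nhds.congr' ?_
    by_cases hω : ω ∈ C
    · obtain ⟨N, hN⟩ := exists_nat_ge (-X.1 ω)
      filter_upwards [eventually_ge_atTop N] with n hn
      have : (N : ℝ) ≤ n := by exact_mod_cast hn
      rw [Set.indicator_of_mem hω, max_eq_left (by linarith)]
    · exact Eventually.of_forall fun n => by simp [hω, h3 hω]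

theorem add_mem_of_acceptsAllLossesOn (h : IsOrderAmbient P 𝒳) {𝒜 : Set 𝒳}
    (h𝒜 : IsAcceptanceSet 𝒜) (hcl : IsClosed 𝒜) (hconv : Convex ℝ 𝒜) {C : Set Ω}
    (hC : AcceptsAllLossesOn 𝒜 C) {d z : 𝒳} (hd : d ∈ 𝒜) (hd0 : ∀ᵐ ω ∂P, d.1 ω ≤ 0)
    (hz : z ∈ localizedSpace 𝒳 C) : d + z ∈ 𝒜 := by
  -- `(1 - t) d + t (z / t)` decreases to `d + z` as `t ↓ 0`.
  have ht : ∀ n : ℕ, (0 : ℝ) < 1 / (n + 1) := fun n => Nat.one_div_pos_of_nat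
  have hmem : ∀ n : ℕ, (1 - 1 / ((n : ℝ) + 1)) • d +
      (1 / ((n : ℝ) + 1)) • (((n : ℝ) + 1) • z) ∈ 𝒜 := by
    intro n
    refine hconv hd (hC.localizedSpace_subset h h𝒜 hcl ?_) ?_ (ht n).le (by ring)
    · rw [mem_localizedSpace_iff] at hz ⊢
      filter_upwards [hz, ae_coe_smul ((n : ℝ) + 1) z] with ω h1 h2 hω
      rw [h2, h1 hω, mul_zero]
    · have : (0 : ℝ) ≤ n := n.cast_nonneg
      rw [sub_nonneg, div_le_one (by positivity)]
      linarith
  have hval : ∀ n : ℕ, ∀ᵐ ω ∂P, ((1 - 1 / ((n : ℝ) + 1)) • d +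
      (1 / ((n : ℝ) + 1)) • (((n : ℝ) + 1) • z)).1 ω =
        (1 - 1 / ((n : ℝ) + 1)) * d.1 ω + z.1 ω := by
    intro n
    filter_upwards [ae_coe_add ((1 - 1 / ((n : ℝ) + 1)) • d)
      ((1 / ((n : ℝ) + 1)) • (((n : ℝ) + 1) • z)), ae_coe_smul (1 - 1 / ((n : ℝ) + 1)) d,
      ae_coe_smul (1 / ((n : ℝ) + 1)) (((n : ℝ) + 1) • z), ae_coe_smul ((n : ℝ) + 1) z]
      with ω h1 h2 h3 h4
    rw [h1, h2, h3, h4, ← mul_assoc, one_div_mul_cancel (Nat.cast_add_one_ne_zero n), one_mul]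
  refine h.mem_of_antitone hcl hmem ?_ ?_
  · filter_upwards [ae_all_iff.2 hval, hd0] with ω h1 h2 m n hmn
    simp only [h1]
    have : 1 / ((n : ℝ) + 1) ≤ 1 / ((m : ℝ) + 1) := Nat.one_div_le_one_div hmn
    have := mul_le_mul_of_nonpos_right (sub_le_sub_left this 1) h2
    linarith
  · filter_upwards [ae_all_iff.2 hval, ae_coe_add d z] with ω h1 h2
    simp only [h1, h2]
    have := (((tendsto_one_div_add_atTop_nhds_zero_nat (𝕜 := ℝ)).const_sub 1).mul_const
      (d.1 ω)).add_const (z.1 ω)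
    simpa using this

/-! ### Failure of tightness -/

/-- If acceptable positions `X j ≤ 0` satisfy `X j ≤ -4 ^ j` on `F j`, then all losses on
`limsup F j` are acceptable. -/
theorem acceptsAllLossesOn_of_seq (h : IsOrderAmbient P 𝒳) {𝒜 : Set 𝒳}
    (h𝒜 : IsAcceptanceSet 𝒜) (h0 : 0 ∈ 𝒜) (hcl : IsClosed 𝒜) (hconv : Convex ℝ 𝒜)
    {X : ℕ → 𝒳} (hX : ∀ j, X j ∈ 𝒜) (hX0 : ∀ j, ∀ᵐ ω ∂P, (X j).1 ω ≤ 0) {F : ℕ → Set Ω}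
    (hF : ∀ j, MeasurableSet (F j)) (hXF : ∀ j, ∀ᵐ ω ∂P, ω ∈ F j → (X j).1 ω ≤ -4 ^ j) :
    AcceptsAllLossesOn 𝒜 (⋂ n, ⋃ j, F (n + j)) := by
  intro k
  set E : Set Ω := ⋂ n, ⋃ j, F (n + j)
  have hE : MeasurableSet E := MeasurableSet.iInter fun n => MeasurableSet.iUnion fun j => hF _
  -- `G m` collects the points of `E` at which the first `m` terms already force a loss of `k`.
  set G : ℕ → Set Ω := fun m => E ∩ ⋃ j ∈ Set.Ico (k + 1) m, F j
  have hG : ∀ m, MeasurableSet (G m) := fun m =>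
    hE.inter (MeasurableSet.biUnion (Set.to_countable _) fun j _ => hF j)
  have hGmono : Monotone G := fun m n hmn =>
    Set.inter_subset_inter_right _ (Set.biUnion_subset_biUnion_left (Set.Ico_subset_Ico_right hmn))
  have hGE : ⋃ m, G m = E := by
    refine Set.Subset.antisymm (Set.iUnion_subset fun m => Set.inter_subset_left) fun ω hω => ?_
    obtain ⟨j, hj⟩ := Set.mem_iUnion.1 (Set.mem_iInter.1 hω (k + 1))
    exact Set.mem_iUnion.2 ⟨k + 1 + j + 1, hω,
      Set.mem_biUnion ⟨Nat.le_add_right _ _, Nat.lt_succ_self _⟩ hj⟩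
  rw [← hGE]
  refine exists_mem_iUnion_of_monotone h hcl hG hGmono k.cast_nonneg fun m => ?_
  obtain ⟨S, hS, hSX⟩ := exists_mem_le_of_seq h0 hconv m X hX hX0
  obtain ⟨Y, hY⟩ := h.exists_indicator_const (hG m) (-(k : ℝ))
  refine ⟨Y, h𝒜.mem_of_ae_le hS ?_, hY⟩
  filter_upwards [hSX, hY, ae_all_iff.2 hXF] with ω h1 h2 h3
  rw [h2]
  by_cases hω : ω ∈ G m
  · rw [Set.indicator_of_mem hω]
    obtain ⟨j, hj, hjF⟩ := Set.mem_iUnion₂.1 hω.2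
    refine (h1.2 j hj.2).trans ((mul_le_mul_of_nonneg_left (h3 j hjF) (by positivity)).trans ?_)
    -- For `j ≥ k + 1` the loss `2^{-(j+1)} 4^j = 2^{j-1}` is at least `k`.
    have hk : (k : ℝ) ≤ 2 ^ (j - 1) := by
      have : k ≤ 2 ^ (j - 1) := (Nat.le_sub_one_of_lt hj.1).trans Nat.lt_two_pow_self.le
      exact_mod_cast this
    obtain ⟨i, rfl⟩ : ∃ i, j = i + 1 := ⟨j - 1, by have := hj.1; omega⟩
    have h4 : (1 / 2 : ℝ) ^ (i + 1 + 1) * -4 ^ (i + 1) = -2 ^ i := by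
      rw [show (4 : ℝ) = 2 * 2 by norm_num, mul_pow, one_div, inv_pow]
      field_simp
      ring
    rw [h4]
    simpa using hk
  · rw [Set.indicator_of_notMem hω]
    exact h1.1

/-- The reverse Fatou lemma for the sets `F j`. -/
theorem le_measureReal_iInter_iUnion [IsProbabilityMeasure P] {F : ℕ → Set Ω}
    (hF : ∀ j, MeasurableSet (F j)) {δ : ℝ} (hδ : ∀ j, δ ≤ P.real (F j)) :
    δ ≤ P.real (⋂ n, ⋃ j, F (n + j)) := by
  have hanti : Antitone fun n => ⋃ j, F (n + j) := by
    intro m n hmn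
    refine Set.iUnion_subset fun j => ?_
    obtain ⟨i, rfl⟩ := Nat.exists_eq_add_of_le hmn
    rw [add_assoc]
    exact Set.subset_iUnion (fun j => F (m + j)) (i + j)
  have hlim := tendsto_measure_iInter_atTop (μ := P)
    (fun n => (MeasurableSet.iUnion fun j => hF (n + j)).nullMeasurableSet) hanti
    ⟨0, measure_ne_top _ _⟩
  refine ge_of_tendsto' ((ENNReal.tendsto_toReal (measure_ne_top _ _)).comp hlim) fun n => ?_
  exact (hδ n).trans (measureReal_mono (Set.subset_iUnion (fun j => F (n + j)) 0))

/-- If no non-null subset of `B` is free, then every set of acceptable nonpositive positions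
concentrated on `B` is tight: otherwise the upper limit of the sets of large loss would be free. -/
theorem isTightSet_of_subset [IsProbabilityMeasure P] (h : IsOrderAmbient P 𝒳) {𝒜 𝒟 : Set 𝒳}
    (h𝒜 : IsAcceptanceSet 𝒜) (h0 : 0 ∈ 𝒜) (hcl : IsClosed 𝒜) (hconv : Convex ℝ 𝒜) {B C : Set Ω}
    (hBC : Disjoint B C)
    (hC : ∀ E, MeasurableSet E → AcceptsAllLossesOn 𝒜 E → P (E \ C) = 0)
    (h𝒟 : 𝒟 ⊆ 𝒜) (h𝒟B : 𝒟 ⊆ localizedNeg 𝒳 B) : IsTightSet 𝒟 := by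
  intro ε hε hε1
  by_contra! hcon
  choose X hX𝒟 hXε using fun j : ℕ => hcon (4 ^ j) (by positivity)
  set F : ℕ → Set Ω := fun j => {ω | (X j).1 ω ≤ -4 ^ j}
  have hF : ∀ j, MeasurableSet (F j) := fun j =>
    measurableSet_le (X j).1.stronglyMeasurable.measurable measurable_const
  have hX0 : ∀ j, ∀ᵐ ω ∂P, (X j).1 ω ≤ 0 := fun j => (mem_localizedNeg_iff.1 (h𝒟B (hX𝒟 j))).2
  have hXB : ∀ j, ∀ᵐ ω ∂P, ω ∉ B → (X j).1 ω = 0 :=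
    fun j => (mem_localizedNeg_iff.1 (h𝒟B (hX𝒟 j))).1
  have hPF : ∀ j, 1 - ε ≤ P.real (F j) := by
    intro j
    -- Since `X j ≤ 0`, the event `-4^j < X j < 4^j` is the complement of `F j`.
    have h1 : P.real (F j)ᶜ ≤ ε := by
      refine le_trans (le_of_eq (measureReal_congr ?_)) (hXε j)
      filter_upwards [hX0 j] with ω h1
      refine propext ⟨fun h2 => ⟨not_le.1 h2, h1.trans_lt (by positivity)⟩, fun h2 => not_le.2 h2.1⟩
    rw [probReal_compl_eq_one_sub (hF j)] at h1
    linarith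
  have hE := acceptsAllLossesOn_of_seq h h𝒜 h0 hcl hconv (fun j => h𝒟 (hX𝒟 j)) hX0 hF
    fun j => Eventually.of_forall fun ω hω => hω
  have hEm : MeasurableSet (⋂ n, ⋃ j, F (n + j)) :=
    MeasurableSet.iInter fun n => MeasurableSet.iUnion fun j => hF _
  have hEB : P ((⋂ n, ⋃ j, F (n + j)) \ B) = 0 := by
    have : ∀ᵐ ω ∂P, ω ∉ (⋂ n, ⋃ j, F (n + j)) \ B := by
      filter_upwards [ae_all_iff.2 hXB] with ω h1 h2
      obtain ⟨j, hj⟩ := Set.mem_iUnion.1 (Set.mem_iInter.1 h2.1 0)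
      have hj : (X (0 + j)).1 ω ≤ -4 ^ (0 + j) := hj
      rw [h1 _ h2.2] at hj
      have : (0 : ℝ) < 4 ^ (0 + j) := by positivity
      linarith
    exact measure_eq_zero_iff_ae_notMem.2 this
  have hnull : P (⋂ n, ⋃ j, F (n + j)) = 0 := by
    refine measure_mono_null (fun ω hω => ?_) (measure_union_null (hC _ hEm hE) hEB)
    by_cases hωB : ω ∈ B
    · exact Or.inl ⟨hω, Set.disjoint_left.1 hBC hωB⟩
    · exact Or.inr ⟨hω, hωB⟩
  have := le_measureReal_iInter_iUnion hF hPF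
  rw [measureReal_def, hnull] at this
  simp only [ENNReal.toReal_zero] at this
  linarith

/-! ### Existence of the decomposition -/

theorem exists_isDecomposition [IsProbabilityMeasure P] (h : IsOrderAmbient P 𝒳) {𝒜 : Set 𝒳}
    (h𝒜 : IsAcceptanceSet 𝒜) (hcl : IsClosed 𝒜) (hconv : Convex ℝ 𝒜)
    (hs : IsSurplusInvariant 𝒜) : ∃ (A B C : Set Ω) (𝒟 : Set 𝒳), IsDecomposition 𝒜 A B C 𝒟 := by
  have h0 := hs.zero_mem h𝒜
  obtain ⟨C, hCm, hC, hCmax⟩ := exists_essentially_largest_set (P := P)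
    (p := AcceptsAllLossesOn 𝒜) (fun n => ⟨0, h0, by
      filter_upwards [ae_coe_zero (𝒳 := 𝒳)] with ω hω
      simp⟩)
    fun E hE hp => AcceptsAllLossesOn.iUnion h h𝒜 hcl hconv hE hp
  obtain ⟨N, hNm, hN, hNmax⟩ := exists_essentially_largest_set (P := P)
    (p := fun E => ∀ X ∈ 𝒜, ∀ᵐ ω ∂P, ω ∈ E → 0 ≤ X.1 ω) (by simp)
    fun E hE hp X hX => by
      filter_upwards [ae_all_iff.2 fun n => hp n X hX] with ω h1 h2
      obtain ⟨n, hn⟩ := Set.mem_iUnion.1 h2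
      exact h1 n hn
  set B : Set Ω := (N ∪ C)ᶜ
  have hBm : MeasurableSet B := (hNm.union hCm).compl
  have hBC : Disjoint B C := Set.disjoint_left.2 fun ω h1 h2 => h1 (Or.inr h2)
  set 𝒟 : Set 𝒳 := 𝒜 ∩ localizedNeg 𝒳 B
  have h𝒟B : 𝒟 ⊆ localizedNeg 𝒳 B := Set.inter_subset_right
  -- The negative part of an acceptable position on `B` lies in `𝒟`.
  have hpart : ∀ X ∈ 𝒜, ∃ d ∈ 𝒟, ∀ᵐ ω ∂P, ω ∈ B → d.1 ω = min (X.1 ω) 0 := by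
    intro X hX
    obtain ⟨Z, hZ⟩ := h.exists_indicator hBm X
    obtain ⟨d, hd⟩ := h.exists_min_zero Z
    refine ⟨d, ⟨hs.mem_of_ae hX ?_, mem_localizedNeg_iff.2 ⟨?_, ?_⟩⟩, ?_⟩
    · filter_upwards [hZ, hd] with ω h1 h2
      rw [h2, h1]
      by_cases hω : ω ∈ B
      · rw [Set.indicator_of_mem hω]
        rcases min_choice (X.1 ω) 0 with h3 | h3
        · exact Or.inr h3.ge
        · exact Or.inl h3.ge
      · exact Or.inl (by simp [hω])
    · filter_upwards [hZ, hd] with ω h1 h2 hω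
      rw [h2, h1, Set.indicator_of_notMem hω, min_self]
    · filter_upwards [hd] with ω h1
      rw [h1]
      exact min_le_right _ _
    · filter_upwards [hZ, hd] with ω h1 h2 hω
      rw [h2, h1, Set.indicator_of_mem hω]
  have hAC : Disjoint (N \ C) C := Set.disjoint_sdiff_left
  have hAB : Disjoint (N \ C) B := Set.disjoint_left.2 fun ω h1 h2 => h2 (Or.inl h1.1)
  have hABC : N \ C ∪ B ∪ C = Set.univ := by
    ext ω
    simp only [B, Set.mem_union, Set.mem_sdiff, Set.mem_compl_iff, Set.mem_univ, iff_true]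
    tauto
  refine ⟨N \ C, B, C, 𝒟, hNm.diff hCm, hBm, hCm, hAB, hAC, hBC, hABC, ?_, h𝒟B, ?_, ?_, ?_,
    isTightSet_of_subset h h𝒜 h0 hcl hconv hBC hCmax Set.inter_subset_left h𝒟B, ?_, ?_⟩
  · -- If `C` had full measure, every position would be acceptable.
    refine lt_of_le_of_ne prob_le_one fun hC1 => h𝒜.ne_univ (Set.eq_univ_of_forall fun X => ?_)
    refine hC.localizedSpace_subset h h𝒜 hcl (mem_localizedSpace_iff.2 ?_)
    filter_upwards [(prob_compl_eq_zero_iff hCm).2 hC1] with ω h1 h2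
    exact absurd h2 (by simpa using h1)
  · have : 𝒟 = 𝒜 ∩ ({X : 𝒳 | ∀ᵐ ω ∂P, ω ∈ Set.univ → 1 * X.1 ω ≤ 0} ∩
        {X : 𝒳 | ∀ᵐ ω ∂P, ω ∈ Bᶜ → -1 * X.1 ω ≤ 0}) := by
      ext X
      refine and_congr_right fun _ => mem_localizedNeg_iff.trans ⟨fun hX => ⟨?_, ?_⟩,
        fun hX => ⟨?_, ?_⟩⟩
      · filter_upwards [hX.2] with ω h1 _
        linarith
      · filter_upwards [hX.1] with ω h1 hω
        rw [h1 hω, mul_zero]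
      · filter_upwards [hX.1, hX.2] with ω h1 h2 hω
        linarith [h1 trivial, h2 hω]
      · filter_upwards [hX.1] with ω h1
        linarith [h1 trivial]
    rw [this]
    exact hcl.inter ((h.isClosed_setOf_ae_nonpos _ MeasurableSet.univ 1).inter
      (h.isClosed_setOf_ae_nonpos _ hBm.compl (-1)))
  · refine hconv.inter fun X hX Y hY a b ha hb hab => ?_
    rw [mem_localizedNeg_iff] at hX hY ⊢
    have hval : ∀ᵐ ω ∂P, (a • X + b • Y).1 ω = a * X.1 ω + b * Y.1 ω := by
      filter_upwards [ae_coe_add (a • X) (b • Y), ae_coe_smul a X, ae_coe_smul b Y] with ω h1 h2 h3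
      rw [h1, h2, h3]
    constructor
    · filter_upwards [hval, hX.1, hY.1] with ω h1 h2 h3 hω
      rw [h1, h2 hω, h3 hω]
      ring
    · filter_upwards [hval, hX.2, hY.2] with ω h1 h2 h3
      rw [h1]
      exact add_nonpos (mul_nonpos_of_nonneg_of_nonpos ha h2)
        (mul_nonpos_of_nonneg_of_nonpos hb h3)
  · intro X hX Y hXY hY
    have hX2 := mem_localizedNeg_iff.1 hX.2
    have hXY' := AEEqFun.coeFn_le.2 hXY
    have hY' := le_zero_iff_ae.1 hY
    refine ⟨h𝒜.monotone X hX.1 Y hXY, mem_localizedNeg_iff.2 ⟨?_, hY'⟩⟩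
    filter_upwards [hX2.1, hXY', hY'] with ω h1 h2 h3 hω
    rw [h1 hω] at h2
    exact le_antisymm h3 h2
  · intro E hEB hEm hE
    by_contra! hcon
    -- Otherwise `E` could be added to `N`, against the maximality of `N`.
    have hEN : ∀ X ∈ 𝒜, ∀ᵐ ω ∂P, ω ∈ E → 0 ≤ X.1 ω := by
      intro X hX
      obtain ⟨d, hd, hdX⟩ := hpart X hX
      have h1 : ∀ᵐ ω ∂P, ¬ E.indicator d.1 ω < 0 := by
        rw [ae_iff]
        simpa using hcon d hd
      filter_upwards [h1, hdX] with ω h1 h2 hω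
      rw [Set.indicator_of_mem hω, h2 (hEB hω)] at h1
      exact (not_lt.1 h1).trans (min_le_left _ _)
    have := hNmax E hEm hEN
    rw [Disjoint.sdiff_eq_left (Set.disjoint_left.2 fun ω h1 h2 => hEB h1 (Or.inl h2))] at this
    exact hE.ne' this
  · convert isDirectSum₃_setOf h (hNm.diff hCm) hBm hCm hAB hAC hBC hABC h𝒟B using 1
    ext X
    constructor
    · intro hX
      obtain ⟨d, hd, hdX⟩ := hpart X hX
      refine ⟨(hN X hX).mono fun ω h1 h2 => h1 h2.1, d, hd, ?_⟩
      filter_upwards [hdX] with ω h1 hω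
      rw [h1 hω]
      exact min_le_left _ _
    · rintro ⟨hXA, d, hd, hdX⟩
      obtain ⟨Z, hZ⟩ := h.exists_indicator hCm X
      obtain ⟨hd0, hd1⟩ := mem_localizedNeg_iff.1 hd.2
      have hZC : Z ∈ localizedSpace 𝒳 C := ⟨X, hZ⟩
      refine h𝒜.mem_of_ae_le (add_mem_of_acceptsAllLossesOn h h𝒜 hcl hconv hC hd.1 hd1 hZC) ?_
      filter_upwards [hXA, hdX, hZ, hd0, hd1, ae_coe_add d Z] with ω h1 h2 h3 h4 h5 h6
      rw [h6, h3]
      by_cases hωC : ω ∈ C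
      · rw [Set.indicator_of_mem hωC]
        linarith
      · rw [Set.indicator_of_notMem hωC, add_zero]
        by_cases hωB : ω ∈ B
        · exact h2 hωB
        · rw [h4 hωB]
          exact h1 ⟨by by_contra hωN; exact hωB fun h => h.elim hωN hωC, hωC⟩

/-! ### Uniqueness of the partition -/

/-- The set `C` of a decomposition is essentially the largest one on which all losses are
acceptable: none is on `A`, and tightness of `𝒟` excludes non-null subsets of `B`. -/
theorem IsDecomposition.measure_diff_eq_zero_iff_acceptsAllLossesOn [IsProbabilityMeasure P]
    (h : IsOrderAmbient P 𝒳) {𝒜 𝒟 : Set 𝒳} (h𝒜 : IsAcceptanceSet 𝒜) {A B C E : Set Ω}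
    (hD : IsDecomposition 𝒜 A B C 𝒟) (hE : MeasurableSet E) :
    P (E \ C) = 0 ↔ AcceptsAllLossesOn 𝒜 E := by
  constructor
  · intro h0 n
    obtain ⟨X, hX⟩ := h.exists_indicator_const hE (-(n : ℝ))
    obtain ⟨Y, hY⟩ := h𝒜.nonempty
    obtain ⟨-, d, hd, -⟩ := (hD.mem_iff h).1 hY
    have hX0 : ∀ᵐ ω ∂P, ω ∉ C → X.1 ω = 0 := by
      filter_upwards [hX, measure_eq_zero_iff_ae_notMem.1 h0] with ω h1 h2 hω
      rw [h1, Set.indicator_of_notMem fun hωE => h2 ⟨hωE, hω⟩]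
    refine ⟨X, (hD.mem_iff h).2 ⟨?_, d, hd, ?_⟩, hX⟩
    · filter_upwards [hX0] with ω h1 hω
      exact (h1 (Set.disjoint_left.1 hD.disjoint_AC hω)).ge
    · filter_upwards [hX0, (mem_localizedNeg_iff.1 (hD.subset_neg hd)).2] with ω h1 h2 hω
      rw [h1 (Set.disjoint_left.1 hD.disjoint_BC hω)]
      exact h2
  · intro hp
    have hEA : P (E ∩ A) = 0 := by
      obtain ⟨X, hX, hXE⟩ := hp 1
      rw [measure_eq_zero_iff_ae_notMem]
      filter_upwards [hXE, ((hD.mem_iff h).1 hX).1] with ω h1 h2 hω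
      have := h2 hω.2
      rw [h1, Set.indicator_of_mem hω.1] at this
      norm_num at this
    have hEB : P (E ∩ B) = 0 := by
      by_contra hne
      have hpos : 0 < P.real (E ∩ B) := ENNReal.toReal_pos hne (measure_ne_top _ _)
      have hle : P.real (E ∩ B) ≤ 1 := measureReal_le_one
      obtain ⟨M, hM, hMd⟩ := hD.tight (1 - P.real (E ∩ B) / 2) (by linarith) (by linarith)
      obtain ⟨n, hn⟩ := exists_nat_ge M
      obtain ⟨X, hX, hXE⟩ := hp n
      obtain ⟨-, d, hd, hdX⟩ := (hD.mem_iff h).1 hX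
      have h1 := hMd d hd
      have h2 : P.real {ω | -M < d.1 ω ∧ d.1 ω < M} ≤ P.real (E ∩ B)ᶜ := by
        refine ENNReal.toReal_mono (measure_ne_top _ _) (measure_mono_ae ?_)
        filter_upwards [hXE, hdX] with ω h3 h4 h5 hω
        have h6 := h4 hω.2
        rw [h3, Set.indicator_of_mem hω.1] at h6
        have h7 : -M < d.1 ω := h5.1
        linarith
      rw [probReal_compl_eq_one_sub (hE.inter hD.measurableSet_B)] at h2
      linarith
    refine measure_mono_null (fun ω hω => ?_) (measure_union_null hEA hEB)
    have : ω ∈ A ∪ B ∪ C := hD.union_eq ▸ Set.mem_univ ω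
    rcases this with (h1 | h1) | h1
    · exact Or.inl ⟨hω.1, h1⟩
    · exact Or.inr ⟨hω.1, h1⟩
    · exact absurd h1 hω.2

/-- The set `A` of a decomposition is essentially the largest one on which all acceptable
positions are nonnegative: sensitivity of `𝒟` excludes non-null subsets of `B`. -/
theorem IsDecomposition.measure_diff_eq_zero_iff_forall_nonneg [IsProbabilityMeasure P]
    (h : IsOrderAmbient P 𝒳) {𝒜 𝒟 : Set 𝒳} (h𝒜 : IsAcceptanceSet 𝒜) {A B C E : Set Ω}
    (hD : IsDecomposition 𝒜 A B C 𝒟) (hE : MeasurableSet E) :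
    P (E \ A) = 0 ↔ ∀ X ∈ 𝒜, ∀ᵐ ω ∂P, ω ∈ E → 0 ≤ X.1 ω := by
  constructor
  · intro h0 X hX
    filter_upwards [((hD.mem_iff h).1 hX).1, measure_eq_zero_iff_ae_notMem.1 h0] with ω h1 h2 hω
    exact h1 (by by_contra hωA; exact h2 ⟨hω, hωA⟩)
  · intro hp
    have hEC : P (E ∩ C) = 0 := by
      have h1 : AcceptsAllLossesOn 𝒜 (E ∩ C) :=
        (hD.measure_diff_eq_zero_iff_acceptsAllLossesOn h h𝒜 (hE.inter hD.measurableSet_C)).1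
          (by rw [Set.sdiff_eq_empty.2 Set.inter_subset_right, measure_empty])
      obtain ⟨X, hX, hXE⟩ := h1 1
      rw [measure_eq_zero_iff_ae_notMem]
      filter_upwards [hXE, hp X hX] with ω h2 h3 hω
      have := h3 hω.1
      rw [h2, Set.indicator_of_mem hω] at this
      norm_num at this
    have hEB : P (E ∩ B) = 0 := by
      by_contra hne
      obtain ⟨X, hX, hXE⟩ := hD.sensitive (E ∩ B) Set.inter_subset_right
        (hE.inter hD.measurableSet_B) (pos_iff_ne_zero.2 hne)
      have hX𝒜 : X ∈ 𝒜 := by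
        refine (hD.mem_iff h).2 ⟨?_, X, hX, Eventually.of_forall fun ω _ => le_rfl⟩
        filter_upwards [(mem_localizedNeg_iff.1 (hD.subset_neg hX)).1] with ω h1 hω
        exact (h1 (Set.disjoint_left.1 hD.disjoint_AB hω)).ge
      refine hXE.ne' ?_
      rw [measure_eq_zero_iff_ae_notMem]
      filter_upwards [hp X hX𝒜] with ω h1 hω
      exact absurd hω (not_lt.2 (Set.indicator_apply_nonneg fun h2 => h1 h2.1))
    refine measure_mono_null (fun ω hω => ?_) (measure_union_null hEB hEC)
    have : ω ∈ A ∪ B ∪ C := hD.union_eq ▸ Set.mem_univ ω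
    rcases this with (h1 | h1) | h1
    · exact absurd h1 hω.2
    · exact Or.inl ⟨hω.1, h1⟩
    · exact Or.inr ⟨hω.1, h1⟩

theorem IsDecomposition.ae_unique [IsProbabilityMeasure P] (h : IsOrderAmbient P 𝒳) {𝒜 𝒟 𝒟' : Set 𝒳}
    (h𝒜 : IsAcceptanceSet 𝒜) {A B C A' B' C' : Set Ω} (hD : IsDecomposition 𝒜 A B C 𝒟)
    (hD' : IsDecomposition 𝒜 A' B' C' 𝒟') : A' =ᵐ[P] A ∧ B' =ᵐ[P] B ∧ C' =ᵐ[P] C := by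
  have hCC : C' =ᵐ[P] C := ae_eq_set.2
    ⟨(hD.measure_diff_eq_zero_iff_acceptsAllLossesOn h h𝒜 hD'.measurableSet_C).2
      ((hD'.measure_diff_eq_zero_iff_acceptsAllLossesOn h h𝒜 hD'.measurableSet_C).1 (by simp)),
    (hD'.measure_diff_eq_zero_iff_acceptsAllLossesOn h h𝒜 hD.measurableSet_C).2
      ((hD.measure_diff_eq_zero_iff_acceptsAllLossesOn h h𝒜 hD.measurableSet_C).1 (by simp))⟩
  have hAA : A' =ᵐ[P] A := ae_eq_set.2
    ⟨(hD.measure_diff_eq_zero_iff_forall_nonneg h h𝒜 hD'.measurableSet_A).2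
      ((hD'.measure_diff_eq_zero_iff_forall_nonneg h h𝒜 hD'.measurableSet_A).1 (by simp)),
    (hD'.measure_diff_eq_zero_iff_forall_nonneg h h𝒜 hD.measurableSet_A).2
      ((hD.measure_diff_eq_zero_iff_forall_nonneg h h𝒜 hD.measurableSet_A).1 (by simp))⟩
  have hcompl : ∀ {A B C : Set Ω} {𝒟 : Set 𝒳}, IsDecomposition 𝒜 A B C 𝒟 → B = (A ∪ C)ᶜ := by
    intro A B C 𝒟 hD
    ext ω
    have h1 : ω ∈ A ∪ B ∪ C := hD.union_eq ▸ Set.mem_univ ω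
    have h2 : ω ∈ A → ω ∉ B := fun hx => Set.disjoint_left.1 hD.disjoint_AB hx
    have h3 : ω ∈ B → ω ∉ C := fun hx => Set.disjoint_left.1 hD.disjoint_BC hx
    simp only [Set.mem_union, Set.mem_compl_iff] at h1 ⊢
    tauto
  refine ⟨hAA, ?_, hCC⟩
  rw [hcompl hD, hcompl hD']
  exact (hAA.union hCC).compl

end Sets

theorem mainTheorem1 {Ω : Type*} [MeasurableSpace Ω] (P : Measure Ω) [IsProbabilityMeasure P]
    (𝒳 : Submodule ℝ (Ω →ₘ[P] ℝ)) [TopologicalSpace 𝒳] (h𝒳 : IsAmbientSpace P 𝒳)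
    (𝒜 : Set 𝒳) (h𝒜 : IsAcceptanceSet 𝒜) (hclosed : IsClosed 𝒜) (hconvex : Convex ℝ 𝒜) :
    IsSurplusInvariant 𝒜 ↔
      ∃ A B C : Set Ω, (∃ 𝒟 : Set 𝒳, IsDecomposition 𝒜 A B C 𝒟) ∧
        ∀ A' B' C' : Set Ω, (∃ 𝒟' : Set 𝒳, IsDecomposition 𝒜 A' B' C' 𝒟') →
          A' =ᵐ[P] A ∧ B' =ᵐ[P] B ∧ C' =ᵐ[P] C := by
  have h := h𝒳.isOrderAmbient
  constructor
  · intro hs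
    obtain ⟨A, B, C, 𝒟, hD⟩ := exists_isDecomposition h h𝒜 hclosed hconvex hs
    exact ⟨A, B, C, ⟨𝒟, hD⟩, fun A' B' C' ⟨𝒟', hD'⟩ => hD.ae_unique h h𝒜 hD'⟩
  · rintro ⟨A, B, C, ⟨𝒟, hD⟩, -⟩
    exact hD.isSurplusInvariant h
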